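/- Let $(S,g)$ be a compact connected smooth Riemannian surface, with or without boundary, with area measure $\mathrm{area}$ induced by $g$, and let $n\ge 2$. Let $C_n(S)=\{x\in S^n : x_i\ne x_j \text{ for } i\ne j\}$ be the configuration space of $n$ ordered points, let $g^n$ be the product metric on $S^n$, and let $\mu$ be the measure on $C_n(S)$ induced by $g^n$, i.e. the restriction of the product measure $\mathrm{area}^{\otimes n}$. For $x\in S^n$ let $d(x)$ be the distance, in the metric $d_{g^n}$ induced by $g^n$, from $x$ to the union of the diagonals $D_{ij}=\{y\in S^n : y_i=y_j\}$, $i\neq j$, and define on $C_n(S)$ the continuous Riemannian metric $g_b$ by $|v|_{g_b}=|v|_{g^n}/d(x)$ for $v\in T_xC_n(S)$. For a manifold $M$ (possibly with boundary or corners) with a measure $\nu$, let $\mathrm{Diff}_0(M,\nu)$ be the group of smooth diffeomorphisms of $M$ that preserve $\nu$ and are smoothly isotopic to the identity. If $M$ carries a continuous Riemannian metric $h$, then for $f\in\mathrm{Diff}_0(M,\nu)$ put $$l_1(f)=\inf_{\{f_t\}}\int_0^1\int_M|\dot f_t(x)|_h\,d\nu(x)\,dt\in[0,\infty],$$ where the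 infimum is over all smooth isotopies $\{f_t\}_{t\in[0,1]}$ with $f_t\in\mathrm{Diff}_0(M,\nu)$ for all $t$, $f_0=\mathrm{id}$ and $f_1=f$, and $\inf\emptyset=\infty$. On $\mathrm{Diff}_0(S,\mathrm{area})$ use $h=g$, and on $\mathrm{Diff}_0(C_n(S),\mu)$ use $h=g_b$. Then $f\mapsto f_*$, $f_*(x_1,\dots,x_n)=(f(x_1),\dots,f(x_n))$, maps $\mathrm{Diff}_0(S,\mathrm{area})$ injectively into $\mathrm{Diff}_0(C_n(S),\mu)$, and this product embedding is Lipschitz: there is a constant $C\in[0,\infty)$ (depending only on $(S,g)$ and $n$) such that $$l_1(f_*)\le C\,l_1(f)\qquad\text{for every } f\in\mathrm{Diff}_0(S,\mathrm{area}).$$ -/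

import Mathlib

open Set MeasureTheory Bundle
open scoped Manifold ContDiff ENNReal NNReal

noncomputable section

namespace SurfaceDiff

section Isotopies

variable {E H M : Type*} [NormedAddCommGroup E] [NormedSpace ℝ E] [TopologicalSpace H]
  [TopologicalSpace M] [ChartedSpace H M]

/-- A smooth isotopy of `M` from the identity to `f`, i.e. a family of diffeomorphisms `F t`,
`t ∈ [0,1]`, such that `(x, t) ↦ F t x` is smooth on `M × [0,1]`, `F 0 = id` and `F 1 = f`.
The values of `F` outside `[0,1]` are irrelevant. -/
structure IsIsotopy (J : ModelWithCorners ℝ E H) (F : ℝ → Equiv.Perm M) (f : Equiv.Perm M) :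
    Prop where
  diffeo : ∀ t ∈ Icc (0 : ℝ) 1, ∃ φ : Diffeomorph J J M M ∞, φ.toEquiv = F t
  smooth : ContMDiffOn (J.prod 𝓘(ℝ, ℝ)) J ∞ (fun q : M × ℝ => F q.2 q.1) (univ ×ˢ Icc (0 : ℝ) 1)
  zero : F 0 = 1
  one : F 1 = f

/-- `Diff₀(M, μ)`: the diffeomorphisms of `M` that preserve `μ` and are isotopic to the identity
(as a set of bijections of `M`). -/
def Diff0 [MeasurableSpace M] (J : ModelWithCorners ℝ E H) (μ : Measure M) :
    Set (Equiv.Perm M) :=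
  {f | (∃ φ : Diffeomorph J J M M ∞, φ.toEquiv = f) ∧ MeasurePreserving f μ μ ∧
    ∃ F, IsIsotopy J F f}

/-- The `L¹`-length `∫₀¹ ∫_M |(d/dt) F t x| dμ(x) dt` of an isotopy. Here `N x v` is the length of
the tangent vector `v` at `x`; it comes from a (possibly only continuous) Riemannian metric which
need not be related to `μ`. -/
def isotopyLength [MeasurableSpace M] (J : ModelWithCorners ℝ E H)
    (N : ∀ x : M, TangentSpace J x → ℝ≥0∞) (μ : Measure M) (F : ℝ → Equiv.Perm M) : ℝ≥0∞ :=
  ∫⁻ t in Icc (0 : ℝ) 1, ∫⁻ x,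
    N (F t x) (mfderivWithin 𝓘(ℝ, ℝ) J (fun s : ℝ => F s x) (Icc 0 1) t (1 : ℝ)) ∂μ

/-- The `L¹`-norm of `f`: the infimum of the `L¹`-lengths of the smooth isotopies in `Diff₀(M, μ)`
that connect the identity with `f` (`∞` if there is none). -/
def l1Norm [MeasurableSpace M] (J : ModelWithCorners ℝ E H)
    (N : ∀ x : M, TangentSpace J x → ℝ≥0∞) (μ : Measure M) (f : Equiv.Perm M) : ℝ≥0∞ :=
  ⨅ (F : ℝ → Equiv.Perm M) (_ : IsIsotopy J F f) (_ : ∀ t ∈ Icc (0 : ℝ) 1, F t ∈ Diff0 J μ),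
    isotopyLength J N μ F

end Isotopies

section Area

variable {H S : Type*} [TopologicalSpace H] (I : ModelWithCorners ℝ (EuclideanSpace ℝ (Fin 2)) H)
  [TopologicalSpace S] [ChartedSpace H S] [RiemannianBundle (fun x : S => TangentSpace I x)]

/-- The coordinate vector field `∂ᵢ` of the preferred chart at `x`, at the point with
coordinates `y`. -/
def coordField (x : S) (i : Fin 2) (y : EuclideanSpace ℝ (Fin 2)) :
    TangentSpace I ((extChartAt I x).symm y) :=
  mfderivWithin 𝓘(ℝ, EuclideanSpace ℝ (Fin 2)) I (extChartAt I x).symm (range I) y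
    (EuclideanSpace.single i (1 : ℝ))

/-- The density `√(det (g(∂ᵢ, ∂ⱼ)))` of the area in the preferred chart at `x`. -/
def areaDensity (x : S) (y : EuclideanSpace ℝ (Fin 2)) : ℝ≥0∞ :=
  ENNReal.ofReal (Real.sqrt (Matrix.det (Matrix.of fun i j : Fin 2 =>
    (inner ℝ (coordField I x i y) (coordField I x j y) : ℝ))))

/-- The area measure on the domain of the preferred chart at `x` (extended by zero to `S`). -/
def chartArea [MeasurableSpace S] (x : S) : Measure S :=
  ((volume.restrict (extChartAt I x).target).withDensity (areaDensity I x)).map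
    (extChartAt I x).symm

/-- The measure on `S` induced by the Riemannian metric. By the change of variables formula the
measures `chartArea I x` agree on the overlaps of the charts, and their supremum (in the lattice of
measures) is the measure glued from them. -/
def area [MeasurableSpace S] : Measure S := ⨆ x : S, chartArea I x

end Area

section Configuration

variable {H S : Type*} [TopologicalSpace H] (I : ModelWithCorners ℝ (EuclideanSpace ℝ (Fin 2)) H)
  [TopologicalSpace S]

/-- The configuration space `C_n(S)` of `n` ordered distinct points of `S`, as an open subset
of `S^n`. -/
def Conf (S : Type*) [TopologicalSpace S] [T2Space S] (n : ℕ) :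
    TopologicalSpace.Opens (Fin n → S) where
  carrier := {x | ∀ i j, i ≠ j → x i ≠ x j}
  is_open' := by
    simp only [ofPred_forall]
    refine isOpen_iInter_of_finite fun i => isOpen_iInter_of_finite fun j =>
      isOpen_iInter_of_finite fun _ => ?_
    exact isOpen_ne_fun (continuous_apply i) (continuous_apply j)

/-- The product map `f ↦ f_*`, `f_*(x₁, …, xₙ) = (f x₁, …, f xₙ)`. -/
def productMap [T2Space S] (n : ℕ) : Equiv.Perm S →* Equiv.Perm (Conf S n) where
  toFun f :=
    { toFun := fun x => ⟨fun i => f (x.1 i), fun i j h e => x.2 i j h (f.injective e)⟩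
      invFun := fun x => ⟨fun i => f.symm (x.1 i), fun i j h e => x.2 i j h (f.symm.injective e)⟩
      left_inv := fun x => by ext; simp
      right_inv := fun x => by ext; simp }
  map_one' := by ext; rfl
  map_mul' f g := by ext; rfl

/-- The measure on `C_n(S)` induced by the product metric: the restriction of the product of the
area measures. -/
def confMeasure [ChartedSpace H S] [RiemannianBundle (fun x : S => TangentSpace I x)]
    [T2Space S] [MeasurableSpace S] (n : ℕ) : Measure (Conf S n) :=
  (Measure.pi fun _ : Fin n => area (S := S) I).comap Subtype.val

/-- The model of `S^n` (and of its open subset `C_n(S)`). -/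
abbrev confModel (n : ℕ) :
    ModelWithCorners ℝ (Fin n → EuclideanSpace ℝ (Fin 2)) (ModelPi fun _ : Fin n => H) :=
  ModelWithCorners.pi fun _ : Fin n => I

variable [ChartedSpace H S] [RiemannianBundle (fun x : S => TangentSpace I x)]

/-- The length of tangent vectors of `S^n` in the product metric `g^n`: the root of the sum of the
squares of the lengths of the components, which are the images under the projections to `S`. -/
def productNorm (n : ℕ) (x : Fin n → S) (v : TangentSpace (confModel I n) x) : ℝ≥0∞ :=
  ENNReal.ofReal (Real.sqrt
    (∑ i, ‖mfderiv (confModel I n) I (fun y : Fin n → S => y i) x v‖ ^ 2))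

/-- The distance of `S^n` induced by `g^n`: the infimum of the `g^n`-lengths of `C¹` paths. -/
def productEDist (n : ℕ) (x y : Fin n → S) : ℝ≥0∞ :=
  letI : ∀ z : Fin n → S, ENorm (TangentSpace (confModel I n) z) := fun z => ⟨productNorm I n z⟩
  Manifold.riemannianEDist (confModel I n) x y

/-- The distance `d(x)` of `x ∈ S^n` to the union of the diagonals `x_i = x_j`, `i ≠ j`. -/
def diagDist (n : ℕ) (x : Fin n → S) : ℝ≥0∞ :=
  ⨅ y ∈ {y : Fin n → S | ∃ i j, i ≠ j ∧ y i = y j}, productEDist I n x y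

/-- The length `|v|_{g_b} = |v|_{g^n} / d(x)` of tangent vectors of `C_n(S)`; the tangent vector
`v` of `C_n(S)` is seen as a tangent vector of `S^n` by means of the inclusion. -/
def gbNorm [T2Space S] (n : ℕ) (x : Conf S n) (v : TangentSpace (confModel I n) x) : ℝ≥0∞ :=
  productNorm I n x.1
    (mfderiv (confModel I n) (confModel I n) (Subtype.val : Conf S n → (Fin n → S)) x v) /
    diagDist I n x.1

end Configuration

end SurfaceDiff

end

/-! An isotopy `F` of `S` induces the isotopy `productMap n (F t)` of the configuration space, so it
suffices to bound the length of the second by a constant times that of the first, with a constant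
independent of `F`, and then pass to the infimum.

At time `t` the `g_b`-speed at `x` is at most `∑ i, |Ḟ_t(x_i)|` divided by the distance of `F_t x`
to the diagonals. A point `y` with `y_i = y_j` satisfies `d(x_i, x_j) ≤ 2 d(x, y)` by the triangle
inequality, so `1 / d(x) ≤ ∑ 2 / d(x_i, x_j)` over pairs `i ≠ j` (`inv_diagDist_le`). Integration
over `S^n` leaves terms `|Ḟ_t(x_i)| / d(F_t x_j, F_t x_l)` with `j ≠ l`. By symmetry `l ≠ i` may be
assumed. Integrating out `x_l` first, area preservation removes `F_t` and leaves `∫ 1 / d(u, y) dy`,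
which is bounded uniformly in `u`. The other variables contribute a power of the total area and the
`L¹`-speed of `F_t` (`lintegral_pi_mul_kernel_le`).

The uniform bound expresses that `1 / r` is locally integrable in dimension two. To transfer it from
the plane, `exists_kernel` replaces `d` by a continuous minorant `δ`, a maximum of finitely many
rescaled Euclidean distances in cut-off charts, and dominates the area by a finite sum of images of
Lebesgue measure. -/

noncomputable section

/-! ### Smooth maps into finite products of manifolds. -/

section PiManifold

variable {ι E' H' N : Type*} [Fintype ι] [NormedAddCommGroup E'] [NormedSpace ℝ E']
  [TopologicalSpace H'] {J : ModelWithCorners ℝ E' H'} [TopologicalSpace N] [ChartedSpace H' N]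
  {E H M : ι → Type*} [∀ i, NormedAddCommGroup (E i)] [∀ i, NormedSpace ℝ (E i)]
  [∀ i, TopologicalSpace (H i)] [∀ i, TopologicalSpace (M i)] [∀ i, ChartedSpace (H i) (M i)]
  {I : ∀ i, ModelWithCorners ℝ (E i) (H i)} {m : ℕ∞ω}

/-- A map into a finite product of manifolds is smooth iff its components are. -/
theorem contMDiffWithinAt_piManifold {f : N → ∀ i, M i} {s : Set N} {x : N} :
    ContMDiffWithinAt J (ModelWithCorners.pi I) m f s x ↔
      ∀ i, ContMDiffWithinAt J (I i) m (fun y => f y i) s x := by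
  simp only [contMDiffWithinAt_iff, continuousWithinAt_pi, forall_and]
  refine and_congr_right fun _ => ?_
  rw [← contDiffWithinAt_pi]
  rfl

theorem contMDiffOn_piManifold {f : N → ∀ i, M i} {s : Set N} :
    ContMDiffOn J (ModelWithCorners.pi I) m f s ↔
      ∀ i, ContMDiffOn J (I i) m (fun y => f y i) s :=
  ⟨fun h i x hx => contMDiffWithinAt_piManifold.1 (h x hx) i,
    fun h x hx => contMDiffWithinAt_piManifold.2 fun i => h i x hx⟩

theorem contMDiff_piManifold {f : N → ∀ i, M i} :
    ContMDiff J (ModelWithCorners.pi I) m f ↔ ∀ i, ContMDiff J (I i) m (fun y => f y i) := by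
  simp only [← contMDiffOn_univ, contMDiffOn_piManifold]

theorem contMDiff_eval_piManifold (i : ι) :
    ContMDiff (ModelWithCorners.pi I) (I i) m (fun x : ∀ i, M i => x i) :=
  contMDiff_piManifold.1 contMDiff_id i

end PiManifold

namespace SurfaceDiff

/-! ### Second countability and infinitude of the surface. -/

section SecondCountable

/-- A compact manifold is second countable. -/
theorem secondCountableTopology_of_model {E H M : Type*} [NormedAddCommGroup E] [NormedSpace ℝ E]
    [SecondCountableTopology E] [TopologicalSpace H] (I : ModelWithCorners ℝ E H)
    [TopologicalSpace M] [CompactSpace M] [ChartedSpace H M] : SecondCountableTopology M :=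
  haveI := I.secondCountableTopology
  ChartedSpace.secondCountable_of_sigmaCompact H M

/-- A nonempty manifold of positive dimension is infinite. -/
theorem infinite_of_model {E H M : Type*} [NormedAddCommGroup E] [NormedSpace ℝ E]
    [Nontrivial E] [TopologicalSpace H] (I : ModelWithCorners ℝ E H)
    [TopologicalSpace M] [ChartedSpace H M] [Nonempty M] : Infinite M := by
  obtain ⟨x⟩ := ‹Nonempty M›
  by_contra hfin
  rw [not_infinite_iff_finite] at hfin
  have hfin' : (extChartAt I x).target.Finite := by
    rw [← (extChartAt I x).image_source_eq_target]
    exact (toFinite _).image _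
  obtain ⟨r, hr, hsub⟩ := Metric.mem_nhdsWithin_iff.1 (extChartAt_target_mem_nhdsWithin (I := I) x)
  -- The range of the model is convex with nonempty interior, so even a boundary point is a limit of
  -- interior points. Hence the chart target contains a nonempty open set of the vector space, which
  -- is infinite.
  have hx : extChartAt I x x ∈ closure (interior (range I)) := by
    rw [I.convex_range.closure_interior_eq_closure_of_nonempty_interior I.nonempty_interior]
    exact subset_closure (mem_range_self _)
  obtain ⟨y, hy, hyr⟩ := Metric.mem_closure_iff.1 hx r hr
  have hopen : IsOpen (Metric.ball (extChartAt I x x) r ∩ interior (range I)) :=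
    Metric.isOpen_ball.inter isOpen_interior
  have hne : (Metric.ball (extChartAt I x x) r ∩ interior (range I)).Nonempty :=
    ⟨y, by rwa [Metric.mem_ball, dist_comm], hy⟩
  exact (infinite_of_mem_nhds hne.some (hopen.mem_nhds hne.some_mem))
    (hfin'.subset ((inter_subset_inter_right _ interior_subset).trans hsub))

end SecondCountable

/-! ### The product embedding: diffeomorphisms, isotopies, measure, injectivity. -/

section Product

variable {H S : Type*} [TopologicalSpace H]
  {I : ModelWithCorners ℝ (EuclideanSpace ℝ (Fin 2)) H}
  [TopologicalSpace S] [T2Space S] [ChartedSpace H S]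

theorem contMDiff_productMap {n : ℕ} {f : Equiv.Perm S} (hf : ContMDiff I I ∞ f) :
    ContMDiff (confModel I n) (confModel I n) ∞ (productMap n f) := by
  rw [← ContMDiff.subtypeVal_comp_iff]
  refine contMDiff_piManifold.2 fun i => ?_
  exact hf.comp ((contMDiff_eval_piManifold (I := fun _ => I) i).comp contMDiff_subtype_val)

theorem exists_diffeomorph_productMap {n : ℕ} {f : Equiv.Perm S}
    (hf : ∃ φ : Diffeomorph I I S S ∞, φ.toEquiv = f) :
    ∃ φ : Diffeomorph (confModel I n) (confModel I n) (Conf S n) (Conf S n) ∞,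
      φ.toEquiv = productMap n f := by
  obtain ⟨φ, rfl⟩ := hf
  exact ⟨⟨productMap n φ.toEquiv, contMDiff_productMap (f := φ.toEquiv) φ.contMDiff,
    contMDiff_productMap (f := φ.symm.toEquiv) φ.symm.contMDiff⟩, rfl⟩

theorem isIsotopy_productMap {n : ℕ} {F : ℝ → Equiv.Perm S} {f : Equiv.Perm S}
    (hF : IsIsotopy I F f) :
    IsIsotopy (confModel I n) (fun t => productMap n (F t)) (productMap n f) where
  diffeo t ht := exists_diffeomorph_productMap (hF.diffeo t ht)
  zero := by simp [hF.zero]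
  one := by simp [hF.one]
  smooth := by
    intro q hq
    rw [← ContMDiffWithinAt.subtypeVal_comp_iff]
    refine contMDiffWithinAt_piManifold.2 fun i => ?_
    have hg : ContMDiff ((confModel I n).prod 𝓘(ℝ, ℝ)) (I.prod 𝓘(ℝ, ℝ)) ∞
        (fun q : Conf S n × ℝ => (q.1.1 i, q.2)) :=
      (((contMDiff_eval_piManifold (I := fun _ => I) i).comp contMDiff_subtype_val).comp
        contMDiff_fst).prodMk contMDiff_snd
    exact (hF.smooth _ ⟨mem_univ _, hq.2⟩).comp q (hg q).contMDiffWithinAt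
      fun p hp => ⟨mem_univ _, hp.2⟩

/-- In an infinite `S` every point is the first entry of some configuration, so `f` can be read off
from the first component of `f_*`. -/
theorem injective_productMap [Infinite S] {n : ℕ} (hn : n ≠ 0) :
    Function.Injective (productMap (S := S) n) := by
  intro f g hfg
  ext x
  obtain ⟨m, rfl⟩ := Nat.exists_eq_succ_of_ne_zero hn
  have : Infinite ({x}ᶜ : Set S) := (finite_singleton x).infinite_compl.to_subtype
  let e := Infinite.natEmbedding ({x}ᶜ : Set S)
  let y : Fin (m + 1) → S := Fin.cons x fun i : Fin m => (e i : S)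
  have hy : Function.Injective y := by
    refine Fin.cons_injective_iff.2 ⟨?_, ?_⟩
    · rintro ⟨i, hi⟩
      exact (e i).2 hi
    · exact Subtype.val_injective.comp (e.injective.comp Fin.val_injective)
  have := congrArg (fun h => (h ⟨y, fun i j hij h => hij (hy h)⟩ : Conf S (m + 1)).1 0) hfg
  exact this

variable [RiemannianBundle (fun x : S => TangentSpace I x)] [MeasurableSpace S] [BorelSpace S]

theorem measurableSet_conf [SecondCountableTopology S] (n : ℕ) :
    MeasurableSet {x : Fin n → S | x ∈ Conf S n} :=
  (Conf S n).isOpen.measurableSet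

/-- The product map preserves the product measure on `S^n`, and the configuration space is its own
preimage under it, since `f` is injective and well defined on equal points. -/
theorem measurePreserving_productMap [SecondCountableTopology S]
    [SigmaFinite (area (S := S) I)] {n : ℕ} {f : Equiv.Perm S}
    (hf : MeasurePreserving f (area (S := S) I) (area (S := S) I)) :
    MeasurePreserving (productMap n f) (confMeasure (S := S) I n) (confMeasure (S := S) I n) := by
  have hpi := measurePreserving_pi (fun _ : Fin n => area (S := S) I) (fun _ => area (S := S) I)
    (fun _ => hf)
  have hemb : MeasurableEmbedding (Subtype.val : Conf S n → Fin n → S) :=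
    MeasurableEmbedding.subtype_coe (measurableSet_conf (S := S) n)
  have hm : Measurable (productMap n f : Conf S n → Conf S n) := by
    refine Measurable.subtype_mk (measurable_pi_lambda _ fun i => ?_)
    exact hf.measurable.comp ((measurable_pi_apply i).comp measurable_subtype_coe)
  refine ⟨hm, ?_⟩
  ext s hs
  rw [Measure.map_apply hm hs, confMeasure, hemb.comap_apply, hemb.comap_apply,
    ← hpi.measure_preimage (hemb.measurableSet_image.2 hs).nullMeasurableSet]
  congr 1
  ext x
  constructor
  · rintro ⟨y, hy, rfl⟩
    exact ⟨_, hy, rfl⟩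
  · rintro ⟨y, hy, hyx⟩
    refine ⟨⟨x, fun i j hij h => y.2 i j hij ?_⟩, ?_, rfl⟩
    · rw [hyx]
      exact congrArg f h
    · have : productMap n f ⟨x, fun i j hij h => y.2 i j hij (by rw [hyx]; exact congrArg f h)⟩
        = y := Subtype.ext hyx.symm
      rw [mem_preimage, this]
      exact hy

theorem mapsTo_productMap [SecondCountableTopology S]
    [SigmaFinite (area (S := S) I)] (n : ℕ) :
    MapsTo (productMap n) (Diff0 I (area (S := S) I))
      (Diff0 (confModel I n) (confMeasure (S := S) I n)) := by
  rintro f ⟨hf, hμ, F, hF⟩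
  exact ⟨exists_diffeomorph_productMap hf, measurePreserving_productMap hμ, _, isIsotopy_productMap hF⟩

end Product

/-! ### Velocity of an isotopy. -/

section Velocity

variable {E H M : Type*} [NormedAddCommGroup E] [NormedSpace ℝ E] [TopologicalSpace H]
  {J : ModelWithCorners ℝ E H} [TopologicalSpace M] [ChartedSpace H M]
  {F : ℝ → Equiv.Perm M} {f : Equiv.Perm M}

theorem IsIsotopy.mdifferentiableWithinAt (hF : IsIsotopy J F f) (x : M) {t : ℝ}
    (ht : t ∈ Icc (0 : ℝ) 1) :
    MDifferentiableWithinAt 𝓘(ℝ, ℝ) J (fun s : ℝ => F s x) (Icc 0 1) t := by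
  have h := hF.smooth (x, t) ⟨mem_univ _, ht⟩
  have hg : ContMDiffWithinAt 𝓘(ℝ, ℝ) (J.prod 𝓘(ℝ, ℝ)) ∞ (fun s : ℝ => (x, s)) (Icc 0 1) t :=
    contMDiffWithinAt_const.prodMk contMDiffWithinAt_id
  exact (h.comp t hg fun s hs => ⟨mem_univ _, hs⟩).mdifferentiableWithinAt (by simp)

variable [IsManifold J ∞ M]

/-- The velocity is the tangent map of `(x, t) ↦ F t x` applied to the continuous field `(0, ∂_t)`.
The continuity supplies the measurability needed for Tonelli. -/
theorem IsIsotopy.continuous_velocity (hF : IsIsotopy J F f) {t : ℝ} (ht : t ∈ Icc (0 : ℝ) 1) :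
    Continuous (fun x : M => (⟨F t x,
      mfderivWithin 𝓘(ℝ, ℝ) J (fun s : ℝ => F s x) (Icc 0 1) t (1 : ℝ)⟩ : TangentBundle J M)) := by
  have hU : UniqueMDiffOn (J.prod 𝓘(ℝ, ℝ)) (univ ×ˢ Icc (0 : ℝ) 1 : Set (M × ℝ)) :=
    uniqueMDiffOn_univ.prod (uniqueDiffOn_Icc zero_lt_one).uniqueMDiffOn
  have h1 := hF.smooth.continuousOn_tangentMapWithin (by simp) hU
  have h2 : Continuous (fun x : M => (equivTangentBundleProd J M 𝓘(ℝ, ℝ) ℝ).symm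
      ((⟨x, 0⟩ : TangentBundle J M), (⟨t, (1 : ℝ)⟩ : TangentBundle 𝓘(ℝ, ℝ) ℝ))) := by
    have h3 : Continuous (fun x : M => (⟨x, 0⟩ : TangentBundle J M)) :=
      (Bundle.contMDiff_zeroSection (n := ∞) ℝ (TangentSpace J : M → Type _) (IB := J)
        (F := E)).continuous
    exact (contMDiff_equivTangentBundleProd_symm (n := ∞)).continuous.comp
      (h3.prodMk continuous_const)
  refine (h1.comp_continuous h2 fun x => ⟨mem_univ _, ht⟩).congr fun x => ?_
  have hg : ContMDiffWithinAt 𝓘(ℝ, ℝ) (J.prod 𝓘(ℝ, ℝ)) ∞ (fun s : ℝ => (x, s)) (Icc 0 1) t :=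
    contMDiffWithinAt_const.prodMk contMDiffWithinAt_id
  have hu : UniqueMDiffWithinAt 𝓘(ℝ, ℝ) (Icc (0 : ℝ) 1) t :=
    (uniqueDiffOn_Icc zero_lt_one t ht).uniqueMDiffWithinAt
  have hc := mfderivWithin_comp t ((hF.smooth (x, t) ⟨mem_univ _, ht⟩).mdifferentiableWithinAt
    (by simp)) (hg.mdifferentiableWithinAt (by simp)) (fun s hs => ⟨mem_univ _, hs⟩) hu
  have hd : mfderivWithin 𝓘(ℝ, ℝ) (J.prod 𝓘(ℝ, ℝ)) (fun s : ℝ => (x, s)) (Icc 0 1) t (1 : ℝ) =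
      ((0 : TangentSpace J x), (1 : ℝ)) :=
    DFunLike.congr_fun (((hasMFDerivWithinAt_const x (Icc (0 : ℝ) 1) t (I := 𝓘(ℝ, ℝ)) (I' := J)).prodMk
      (hasMFDerivWithinAt_id (Icc (0 : ℝ) 1) t (I := 𝓘(ℝ, ℝ)))).mfderivWithin hu)
      (1 : ℝ)
  have hc1 : mfderivWithin 𝓘(ℝ, ℝ) J (fun s : ℝ => F s x) (Icc 0 1) t (1 : ℝ) =
      mfderivWithin (J.prod 𝓘(ℝ, ℝ)) J (fun q : M × ℝ => F q.2 q.1) (univ ×ˢ Icc (0 : ℝ) 1) (x, t)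
        (mfderivWithin 𝓘(ℝ, ℝ) (J.prod 𝓘(ℝ, ℝ)) (fun s : ℝ => (x, s)) (Icc 0 1) t (1 : ℝ)) :=
    DFunLike.congr_fun hc (1 : ℝ)
  rw [hc1, hd]
  rfl

end Velocity

/-! ### Continuity of the speed. -/

section Riemannian

variable {E H M : Type*} [NormedAddCommGroup E] [NormedSpace ℝ E] [TopologicalSpace H]
  {J : ModelWithCorners ℝ E H} [TopologicalSpace M] [ChartedSpace H M] [IsManifold J ∞ M]
  [RiemannianBundle (fun x : M => TangentSpace J x)]

theorem isContinuousRiemannianBundle_of_contMDiff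
    [h : IsContMDiffRiemannianBundle J ∞ E (fun x : M => TangentSpace J x)] :
    IsContinuousRiemannianBundle E (fun x : M => TangentSpace J x) := by
  obtain ⟨g, hg, h⟩ := h.exists_contMDiff
  exact ⟨g, hg.continuous, h⟩

variable [IsContinuousRiemannianBundle E (fun x : M => TangentSpace J x)]
  {F : ℝ → Equiv.Perm M} {f : Equiv.Perm M}

theorem IsIsotopy.continuous_speed (hF : IsIsotopy J F f) {t : ℝ} (ht : t ∈ Icc (0 : ℝ) 1) :
    Continuous (fun x : M =>
      ‖mfderivWithin 𝓘(ℝ, ℝ) J (fun s : ℝ => F s x) (Icc 0 1) t (1 : ℝ)‖ₑ) := by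
  have h := hF.continuous_velocity ht
  have h2 := Real.continuous_sqrt.comp (h.inner_bundle h)
  simp only [Function.comp_def, ← norm_eq_sqrt_real_inner] at h2
  simp only [enorm_eq_nnnorm]
  refine ENNReal.continuous_coe.comp ?_
  exact continuous_induced_rng.2 h2

end Riemannian

/-! ### Gram determinants of two vectors. -/

section Gram

variable {V : Type*} [NormedAddCommGroup V] [InnerProductSpace ℝ V]

/-- Under a change of frame the Gram matrix `G` becomes `aᵀ G a`. The root of the factor `a.det ^ 2`
is the Jacobian in the change of variables between charts. -/
theorem det_gram_linearCombination (a : Matrix (Fin 2) (Fin 2) ℝ) (c d : Fin 2 → V)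
    (hd : ∀ i, d i = a 0 i • c 0 + a 1 i • c 1) :
    Matrix.det (Matrix.of fun i j : Fin 2 => (inner ℝ (d i) (d j) : ℝ)) =
      a.det ^ 2 * Matrix.det (Matrix.of fun i j : Fin 2 => (inner ℝ (c i) (c j) : ℝ)) := by
  simp only [Matrix.det_fin_two, Matrix.of_apply, hd, inner_add_left, inner_add_right,
    real_inner_smul_left, real_inner_smul_right, real_inner_comm (c 0) (c 1)]
  ring

theorem det_gram_le (c : Fin 2 → V) {C : ℝ} (hc : ∀ i, ‖c i‖ ≤ C) :
    Matrix.det (Matrix.of fun i j : Fin 2 => (inner ℝ (c i) (c j) : ℝ)) ≤ (C ^ 2) ^ 2 := by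
  simp only [Matrix.det_fin_two, Matrix.of_apply, real_inner_self_eq_norm_sq,
    real_inner_comm (c 0) (c 1)]
  have h0 := pow_le_pow_left₀ (norm_nonneg _) (hc 0) 2
  have h1 := pow_le_pow_left₀ (norm_nonneg _) (hc 1) 2
  nlinarith [mul_le_mul h0 h1 (sq_nonneg _) (sq_nonneg _), sq_nonneg (inner ℝ (c 0) (c 1) : ℝ)]

end Gram

/-! ### Upper bounds for the area in charts. -/

section Area

variable {H S : Type*} [TopologicalSpace H] {I : ModelWithCorners ℝ (EuclideanSpace ℝ (Fin 2)) H}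
  [TopologicalSpace S] [ChartedSpace H S]

/-- The coordinate change between the preferred charts at `x` and at `p`. -/
def transition (I : ModelWithCorners ℝ (EuclideanSpace ℝ (Fin 2)) H) (x p : S) :
    EuclideanSpace ℝ (Fin 2) → EuclideanSpace ℝ (Fin 2) :=
  extChartAt I p ∘ (extChartAt I x).symm

theorem measurableSet_target_extChartAt (x : S) : MeasurableSet (extChartAt I x).target := by
  rw [extChartAt_target]
  exact ((chartAt H x).open_target.preimage I.continuous_symm).measurableSet.inter
    I.isClosed_range.measurableSet

theorem measurableSet_target_inter_preimage [MeasurableSpace S] [BorelSpace S] (x : S) {A : Set S}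
    (hA : MeasurableSet A) :
    MeasurableSet ((extChartAt I x).target ∩ (extChartAt I x).symm ⁻¹' A) := by
  have hT := measurableSet_target_extChartAt (I := I) x
  have hc := (continuousOn_iff_continuous_domRestrict.1 (continuousOn_extChartAt_symm (I := I) x))
  have h := hT.subtype_image (hc.measurable hA)
  convert h using 1
  ext y
  simp [and_comm]

variable [IsManifold I ∞ S]

theorem differentiableWithinAt_transition {x p : S} {y : EuclideanSpace ℝ (Fin 2)}
    (hy : y ∈ (extChartAt I x).target) (hp : (extChartAt I x).symm y ∈ (extChartAt I p).source) :
    DifferentiableWithinAt ℝ (transition I x p) (range I) y := by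
  rw [← mdifferentiableWithinAt_iff_differentiableWithinAt]
  refine MDifferentiableAt.comp_mdifferentiableWithinAt (I' := I) y ?_
    (mdifferentiableWithinAt_extChartAt_symm hy)
  exact mdifferentiableAt_extChartAt (by simpa using hp)

theorem mfderivWithin_extChartAt_symm_eq_comp {x p : S} {y : EuclideanSpace ℝ (Fin 2)}
    (hy : y ∈ (extChartAt I x).target) (hp : (extChartAt I x).symm y ∈ (extChartAt I p).source)
    (v : EuclideanSpace ℝ (Fin 2)) :
    (mfderivWithin 𝓘(ℝ, EuclideanSpace ℝ (Fin 2)) I (extChartAt I x).symm (range I) y v :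
        EuclideanSpace ℝ (Fin 2)) =
      mfderivWithin 𝓘(ℝ, EuclideanSpace ℝ (Fin 2)) I (extChartAt I p).symm (range I)
        (transition I x p y) (fderivWithin ℝ (transition I x p) (range I) y v) := by
  have hyr : y ∈ range I := extChartAt_target_subset_range x hy
  have hev : (extChartAt I x).symm =ᶠ[nhdsWithin y (range I)]
      (extChartAt I p).symm ∘ transition I x p := by
    have h1 : ContinuousWithinAt (extChartAt I x).symm (range I) y :=
      (mdifferentiableWithinAt_extChartAt_symm hy).continuousWithinAt
    filter_upwards [h1.preimage_mem_nhdsWithin ((isOpen_extChartAt_source p).mem_nhds hp)]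
      with z hz
    exact ((extChartAt I p).left_inv hz).symm
  have hu : UniqueMDiffWithinAt 𝓘(ℝ, EuclideanSpace ℝ (Fin 2)) (range I) y :=
    (I.uniqueDiffOn y hyr).uniqueMDiffWithinAt
  have h := mfderivWithin_comp (I := 𝓘(ℝ, EuclideanSpace ℝ (Fin 2)))
    (I' := 𝓘(ℝ, EuclideanSpace ℝ (Fin 2))) (I'' := I) (g := (extChartAt I p).symm)
    (f := transition I x p) (s := range I) (u := range I) y
    (mdifferentiableWithinAt_extChartAt_symm ((extChartAt I p).map_source hp))
    (differentiableWithinAt_transition hy hp).mdifferentiableWithinAt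
    (fun z _ => mem_range_self _) hu
  rw [hev.mfderivWithin_eq_of_mem hyr, mfderivWithin_eq_fderivWithin] at *
  exact DFunLike.congr_fun h v

variable [RiemannianBundle (fun x : S => TangentSpace I x)]

theorem areaDensity_eq_transition {x p : S} {y : EuclideanSpace ℝ (Fin 2)}
    (hy : y ∈ (extChartAt I x).target) (hp : (extChartAt I x).symm y ∈ (extChartAt I p).source) :
    areaDensity I x y = ENNReal.ofReal |(fderivWithin ℝ (transition I x p) (range I) y).det| *
      areaDensity I p (transition I x p y) := by
  set A := fderivWithin ℝ (transition I x p) (range I) y with hA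
  let b := (EuclideanSpace.basisFun (Fin 2) ℝ).toBasis
  let a := LinearMap.toMatrix b b (A : EuclideanSpace ℝ (Fin 2) →ₗ[ℝ] EuclideanSpace ℝ (Fin 2))
  have ha : a.det = A.det := LinearMap.det_toMatrix b _
  have hq : (extChartAt I p).symm (transition I x p y) = (extChartAt I x).symm y :=
    (extChartAt I p).left_inv hp
  -- The two base points are equal only propositionally, so the inner products live on different
  -- tangent spaces and must be transported.
  have hgram : ∀ {q q' : S} (_ : q' = q) (c : Fin 2 → EuclideanSpace ℝ (Fin 2)),
      Matrix.det (Matrix.of fun i j : Fin 2 =>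
        @inner ℝ (TangentSpace I q') _ (c i) (c j)) =
      Matrix.det (Matrix.of fun i j : Fin 2 =>
        @inner ℝ (TangentSpace I q) _ (c i) (c j)) := by
    rintro q q' rfl c
    rfl
  have hlin : ∀ (L : EuclideanSpace ℝ (Fin 2) →L[ℝ] EuclideanSpace ℝ (Fin 2)) (r r' : ℝ)
      (u v : EuclideanSpace ℝ (Fin 2)), L (r • u + r' • v) = r • L u + r' • L v :=
    fun L r r' u v => by simp
  have hcomb := det_gram_linearCombination (V := TangentSpace I ((extChartAt I x).symm y)) a
    (fun i => coordField I p i (transition I x p y)) (fun i => coordField I x i y) (fun i => by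
      have hi : A (EuclideanSpace.single i (1 : ℝ)) =
          a 0 i • EuclideanSpace.single 0 (1 : ℝ) + a 1 i • EuclideanSpace.single 1 (1 : ℝ) := by
        ext j
        fin_cases j <;> simp [a, b, LinearMap.toMatrix_apply]
      refine (mfderivWithin_extChartAt_symm_eq_comp hy hp _).trans ?_
      rw [← hA, hi]
      exact hlin (mfderivWithin 𝓘(ℝ, EuclideanSpace ℝ (Fin 2)) I (extChartAt I p).symm (range I)
        (transition I x p y)) _ _ _ _)
  have hsqrt : ∀ D : ℝ, ENNReal.ofReal (Real.sqrt (a.det ^ 2 * D)) =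
      ENNReal.ofReal |A.det| * ENNReal.ofReal (Real.sqrt D) := fun D => by
    rw [Real.sqrt_mul (sq_nonneg _), Real.sqrt_sq_eq_abs, ENNReal.ofReal_mul (abs_nonneg _), ha]
  refine (congrArg (fun r => ENNReal.ofReal (Real.sqrt r)) hcomb).trans ((hsqrt _).trans ?_)
  exact congrArg (fun r => ENNReal.ofReal |A.det| * ENNReal.ofReal (Real.sqrt r))
    (hgram hq fun i => coordField I p i (transition I x p y)).symm

section LocalBound

attribute [local instance] normedAddCommGroupTangentSpaceVectorSpace
attribute [local instance] normedSpaceTangentSpaceVectorSpace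

/-- Near the centre of the chart, the density of the area is bounded. -/
theorem exists_areaDensity_le
    [IsContinuousRiemannianBundle (EuclideanSpace ℝ (Fin 2)) (fun x : S => TangentSpace I x)]
    (p : S) : ∃ K : ℝ≥0, ∀ᶠ y in nhdsWithin (extChartAt I p p) (range I),
      areaDensity I p y ≤ K := by
  have : IsManifold I 1 S := IsManifold.of_le (n := ∞) (by simp)
  obtain ⟨C, hC, h⟩ := eventually_norm_mfderivWithin_symm_extChartAt_lt I p
  refine ⟨(Real.sqrt ((C ^ 2) ^ 2)).toNNReal, ?_⟩
  filter_upwards [h] with y hy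
  refine ENNReal.ofReal_le_ofReal (Real.sqrt_le_sqrt (det_gram_le _ fun i => ?_))
  refine (ContinuousLinearMap.le_opNorm (mfderivWithin 𝓘(ℝ, EuclideanSpace ℝ (Fin 2)) I
    (extChartAt I p).symm (range I) y) _).trans ?_
  have h1 : ‖(EuclideanSpace.single i (1 : ℝ) : EuclideanSpace ℝ (Fin 2))‖ = 1 := by simp
  exact (mul_le_mul_of_nonneg_left h1.le (norm_nonneg _)).trans ((mul_one _).trans_le hy.le)

end LocalBound

/-- The area measured in an arbitrary chart is controlled by the Lebesgue measure in the preferred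
chart at `p`, near `p`. -/
theorem exists_chartArea_le [MeasurableSpace S] [BorelSpace S]
    [IsContinuousRiemannianBundle (EuclideanSpace ℝ (Fin 2)) (fun x : S => TangentSpace I x)]
    (p : S) : ∃ K : ℝ≥0, ∀ᶠ U in (nhds p).smallSets, ∀ x : S, ∀ A ⊆ U, MeasurableSet A →
      chartArea I x A ≤ K * volume (extChartAt I p '' A) := by
  obtain ⟨K, hK⟩ := exists_areaDensity_le (I := I) p
  have hU0 : ∀ᶠ q in nhds p, q ∈ (extChartAt I p).source ∧ areaDensity I p (extChartAt I p q) ≤ K := by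
    refine Filter.Eventually.and (extChartAt_source_mem_nhds p) ?_
    exact (tendsto_nhdsWithin_iff.2 ⟨continuousAt_extChartAt p,
      Filter.Eventually.of_forall fun q => mem_range_self (f := I) _⟩).eventually hK
  refine ⟨K, ?_⟩
  rw [Filter.eventually_smallSets]
  refine ⟨_, hU0, fun U hU x A hA hAm => ?_⟩
  -- The pushforward along a map that is not a.e. measurable is zero by convention, so that case is
  -- trivial.
  by_cases hmeas : AEMeasurable (extChartAt I x).symm
      ((volume.restrict (extChartAt I x).target).withDensity (areaDensity I x))
  swap
  · rw [chartArea, Measure.map_of_not_aemeasurable hmeas]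
    exact zero_le
  have hT : MeasurableSet (extChartAt I x).target := measurableSet_target_extChartAt x
  have hs : MeasurableSet ((extChartAt I x).target ∩ (extChartAt I x).symm ⁻¹' A) :=
    measurableSet_target_inter_preimage x hAm
  set s := (extChartAt I x).target ∩ (extChartAt I x).symm ⁻¹' A with hsdef
  have hsA : ∀ y ∈ s, (extChartAt I x).symm y ∈ (extChartAt I p).source ∧
      areaDensity I p (transition I x p y) ≤ K := fun y hy => hU (hA hy.2)
  have hinj : InjOn (transition I x p) s := by
    intro y hy z hz h
    exact (extChartAt I x).symm.injOn hy.1 hz.1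
      ((extChartAt I p).injOn (hsA y hy).1 (hsA z hz).1 h)
  -- The Jacobian relating the two densities is cancelled by the change of variables, so the bound
  -- `K`, which depends on `p` only, serves every chart. This uniformity is what a supremum over
  -- charts requires.
  calc chartArea I x A = ∫⁻ y in s, areaDensity I x y := by
        rw [chartArea, Measure.map_apply_of_aemeasurable hmeas hAm, withDensity_apply',
          Measure.restrict_restrict' hT, inter_comm]
    _ = ∫⁻ y in s, ENNReal.ofReal |(fderivWithin ℝ (transition I x p) (range I) y).det| *
          areaDensity I p (transition I x p y) :=
        setLIntegral_congr_fun hs fun y hy => areaDensity_eq_transition hy.1 (hsA y hy).1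
    _ = ∫⁻ w in transition I x p '' s, areaDensity I p w := by
        refine (lintegral_image_eq_lintegral_abs_det_fderiv_mul volume hs (fun y hy => ?_) hinj
          _).symm
        exact (differentiableWithinAt_transition hy.1 (hsA y hy).1).hasFDerivWithinAt.mono
          (inter_subset_left.trans (extChartAt_target_subset_range x))
    _ ≤ ∫⁻ w in transition I x p '' s, K := by
        refine setLIntegral_mono measurable_const ?_
        rintro _ ⟨y, hy, rfl⟩
        exact (hsA y hy).2
    _ = K * volume (transition I x p '' s) := by simp
    _ ≤ K * volume (extChartAt I p '' A) := by
        gcongr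
        rintro _ ⟨y, hy, rfl⟩
        exact mem_image_of_mem _ hy.2

end Area

theorem enorm_apply_le_of_enorm_lt {V W : Type*} [SeminormedAddCommGroup V] [NormedSpace ℝ V]
    [SeminormedAddCommGroup W] [NormedSpace ℝ W] {L : V →L[ℝ] W} {C : ℝ≥0∞} (hL : ‖L‖ₑ < C) (v : V) :
    ‖L v‖ₑ ≤ C * ‖v‖ₑ :=
  (L.le_opENorm v).trans (mul_le_mul_left hL.le _)

/-! ### Smooth maps are Lipschitz for the Riemannian distance. -/

section Lipschitz

open Manifold

variable {E H M G : Type*} [NormedAddCommGroup E] [NormedSpace ℝ E] [TopologicalSpace H]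
  {I : ModelWithCorners ℝ E H} [TopologicalSpace M] [ChartedSpace H M] [IsManifold I ∞ M]
  [RiemannianBundle (fun x : M => TangentSpace I x)]
  [IsContinuousRiemannianBundle E (fun x : M => TangentSpace I x)]
  [NormedAddCommGroup G] [NormedSpace ℝ G] {ψ : M → G}

section Local

attribute [local instance] normedAddCommGroupTangentSpaceVectorSpace
attribute [local instance] normedSpaceTangentSpaceVectorSpace

/-- Near `q` the map factors as `g ∘ extChartAt I q`. The derivative of `g` is bounded by
continuity, that of the chart by continuity of the metric. -/
theorem eventually_enorm_mfderiv_le (hψ : ContMDiff I 𝓘(ℝ, G) ∞ ψ) (q : M) :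
    ∃ C : ℝ≥0, ∀ᶠ x in nhds q, ∀ v : TangentSpace I x,
      @enorm G _ (mfderiv I 𝓘(ℝ, G) ψ x v) ≤ C * ‖v‖ₑ := by
  have : IsManifold I 1 M := IsManifold.of_le (n := ∞) (by simp)
  obtain ⟨C, hC, h⟩ := eventually_enorm_mfderiv_extChartAt_lt I q
  let g : E → G := ψ ∘ (extChartAt I q).symm
  have hg : ContDiffWithinAt ℝ ∞ g (range I) (extChartAt I q q) :=
    (contMDiffAt_iff.1 (hψ q)).2
  have hg' := (hg.fderivWithin_right (m := 0) I.uniqueDiffOn (by simp)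
    (mem_range_self _)).continuousWithinAt
  have hb : ∀ᶠ x in nhds q,
      ‖fderivWithin ℝ g (range I) (extChartAt I q x)‖ₑ <
        (‖fderivWithin ℝ g (range I) (extChartAt I q q)‖₊ + 1 : ℝ≥0) := by
    have ht : Filter.Tendsto (extChartAt I q) (nhds q)
        (nhdsWithin (extChartAt I q q) (range I)) :=
      tendsto_nhdsWithin_iff.2 ⟨continuousAt_extChartAt q,
        Filter.Eventually.of_forall fun q => mem_range_self (f := I) _⟩
    refine (hg'.tendsto.comp ht).enorm.eventually_lt_const ?_
    rw [enorm_eq_nnnorm]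
    exact_mod_cast lt_add_one _
  refine ⟨(‖fderivWithin ℝ g (range I) (extChartAt I q q)‖₊ + 1) * C, ?_⟩
  filter_upwards [hb, h, extChartAt_source_mem_nhds (I := I) q,
    eventually_mem_nhds_iff.2 (extChartAt_source_mem_nhds (I := I) q)] with x hx1 hx2 hx hx' v
  have hev : ψ =ᶠ[nhds x] g ∘ extChartAt I q := by
    filter_upwards [hx'] with z hz
    exact congrArg ψ ((extChartAt I q).left_inv hz).symm
  have hdg : MDifferentiableWithinAt 𝓘(ℝ, E) 𝓘(ℝ, G) g (range I) (extChartAt I q x) := by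
    refine MDifferentiableAt.comp_mdifferentiableWithinAt (I' := I) _
      (hψ.mdifferentiable (by simp) _)
      (mdifferentiableWithinAt_extChartAt_symm ((extChartAt I q).map_source hx))
  have hcomp : mfderiv I 𝓘(ℝ, G) ψ x v = fderivWithin ℝ g (range I) (extChartAt I q x)
      (mfderiv I 𝓘(ℝ, E) (extChartAt I q) x v) := by
    rw [hev.mfderiv_eq]
    have h1 := (hdg.hasMFDerivWithinAt.comp x (s := univ)
      (mdifferentiableAt_extChartAt (by simpa using hx)).hasMFDerivAt.hasMFDerivWithinAt
      (fun z _ => mem_range_self (f := I) _))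
    rw [hasMFDerivWithinAt_univ] at h1
    rw [h1.mfderiv, mfderivWithin_eq_fderivWithin]
    rfl
  rw [hcomp]
  refine (ContinuousLinearMap.le_opENorm _ _).trans ?_
  rw [ENNReal.coe_mul, mul_assoc]
  exact mul_le_mul' hx1.le (enorm_apply_le_of_enorm_lt hx2 v)

end Local

/-- Smooth maps on a compact Riemannian manifold have bounded derivatives. -/
theorem exists_enorm_mfderiv_le [CompactSpace M] (hψ : ContMDiff I 𝓘(ℝ, G) ∞ ψ) :
    ∃ C : ℝ≥0, ∀ x, ∀ v : TangentSpace I x,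
      @enorm G _ (mfderiv I 𝓘(ℝ, G) ψ x v) ≤ C * ‖v‖ₑ := by
  choose C hC using fun q => eventually_enorm_mfderiv_le hψ q
  obtain ⟨t, ht⟩ := CompactSpace.elim_nhds_subcover _ hC
  refine ⟨t.sup C, fun x v => ?_⟩
  obtain ⟨q, hq, hx⟩ := mem_iUnion₂.1 (ht.ge (mem_univ x))
  exact (hx v).trans (by gcongr; exact Finset.le_sup hq)

/-- Smooth maps on a compact Riemannian manifold are Lipschitz for the Riemannian distance. -/
theorem exists_edist_div_le_riemannianEDist [CompactSpace M] (hψ : ContMDiff I 𝓘(ℝ, G) ∞ ψ) :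
    ∃ C : ℝ≥0, C ≠ 0 ∧ ∀ x y, edist (ψ x) (ψ y) / C ≤ riemannianEDist I x y := by
  obtain ⟨C, hC⟩ := exists_enorm_mfderiv_le hψ
  -- The summand `1` keeps the divisor nonzero: in `ℝ≥0∞`, `a / 0 = ⊤` for `a ≠ 0`. A path of length
  -- below `r` then has an image of length at most `(C + 1) * r`, which bounds the chord.
  refine ⟨C + 1, by positivity, fun x y => le_of_forall_gt_imp_ge_of_dense fun r hr => ?_⟩
  obtain ⟨γ, rfl, rfl, hγ, hlt⟩ := exists_lt_of_riemannianEDist_lt hr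
  refine ENNReal.div_le_of_le_mul' (le_trans ?_ (mul_le_mul_right hlt.le _))
  have hd : ContDiffOn ℝ 1 (ψ ∘ γ) (Icc 0 1) :=
    contMDiffOn_iff_contDiffOn.1 ((hψ.of_le (by simp)).comp_contMDiffOn hγ)
  rw [edist_comm, edist_eq_enorm_sub, pathELength_eq_lintegral_mfderivWithin_Icc]
  refine (enorm_sub_le_lintegral_derivWithin_Icc_of_contDiffOn_Icc hd zero_le_one).trans ?_
  rw [← lintegral_const_mul' _ _ ENNReal.coe_ne_top]
  refine setLIntegral_mono' measurableSet_Icc fun t ht => ?_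
  have hcomp := mfderiv_comp_mfderivWithin t (hψ.mdifferentiable (by simp) (γ t))
    (hγ.mdifferentiableOn one_ne_zero t ht)
    (uniqueDiffOn_Icc zero_lt_one t ht).uniqueMDiffWithinAt
  have h1 : derivWithin (ψ ∘ γ) (Icc 0 1) t = mfderiv I 𝓘(ℝ, G) ψ (γ t)
      (mfderivWithin 𝓘(ℝ, ℝ) I γ (Icc 0 1) t (1 : ℝ)) := by
    rw [← fderivWithin_derivWithin, ← mfderivWithin_eq_fderivWithin]
    exact DFunLike.congr_fun hcomp (1 : ℝ)
  rw [h1]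
  exact (hC _ _).trans (mul_le_mul' (by simp) le_rfl)

end Lipschitz

/-! ### Uniform integrability of the inverse distance in the plane. -/

section Plane

/-- The function `w ↦ ‖u - w‖⁻¹` of the plane is integrable on sets of finite area, uniformly
in `u`. -/
theorem exists_lintegral_inv_edist_le {V : Set (EuclideanSpace ℝ (Fin 2))} (hV : volume V ≠ ⊤) :
    ∃ B : ℝ≥0, ∀ u : EuclideanSpace ℝ (Fin 2), ∫⁻ w in V, (edist u w)⁻¹ ≤ B := by
  let g : EuclideanSpace ℝ (Fin 2) → ℝ≥0∞ := (Metric.ball 0 1).indicator fun w => ‖w‖ₑ⁻¹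
  have hg : ∫⁻ w, g w ≠ ⊤ := by
    have hint : IntegrableOn (fun w : EuclideanSpace ℝ (Fin 2) => ‖w‖⁻¹) (Metric.ball 0 1) := by
      refine integrableOn_ball_of_norm_le_rpow (by simp) (C := 1) (α := 1) (by simp) ?_
        (by fun_prop)
      refine Filter.Eventually.of_forall fun w => ?_
      simp [Real.rpow_neg_one]
    rw [lintegral_indicator measurableSet_ball]
    refine ne_of_eq_of_ne ?_ hint.2.ne
    refine lintegral_congr_ae ?_
    -- At `0` the real inverse is `0` while the extended one is `∞`, so the two integrands agree
    -- only off the origin.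
    have h0 : ∀ᵐ w : EuclideanSpace ℝ (Fin 2) ∂volume.restrict (Metric.ball 0 1), w ≠ 0 :=
      ae_restrict_of_ae (Measure.ae_ne volume 0)
    filter_upwards [h0] with w hw
    rw [enorm_inv (norm_ne_zero_iff.2 hw), enorm_norm]
  refine ⟨((∫⁻ w, g w) + volume V).toNNReal, fun u => ?_⟩
  rw [ENNReal.coe_toNNReal (ENNReal.add_ne_top.2 ⟨hg, hV⟩)]
  -- The singularity is confined to the unit ball about `u`, and elsewhere the function is at most
  -- `1`. Translation invariance makes the resulting bound independent of `u`.
  have hpt : ∀ w, (edist u w)⁻¹ ≤ g (w - u) + 1 := by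
    intro w
    rw [edist_comm, edist_eq_enorm_sub]
    by_cases hw : w - u ∈ Metric.ball (0 : EuclideanSpace ℝ (Fin 2)) 1
    · simp only [g, indicator_of_mem hw]
      exact le_self_add
    · refine le_add_left (ENNReal.inv_le_one.2 ?_)
      rw [mem_ball_zero_iff, not_lt] at hw
      rw [enorm_eq_nnnorm]
      exact_mod_cast hw
  calc ∫⁻ w in V, (edist u w)⁻¹ ≤ ∫⁻ w in V, (g (w - u) + 1) := lintegral_mono hpt
    _ = (∫⁻ w in V, g (w - u)) + volume V := by
        rw [lintegral_add_right _ measurable_const]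
        simp
    _ ≤ (∫⁻ w, g (w - u)) + volume V := by
        gcongr
        exact Measure.restrict_le_self
    _ = (∫⁻ w, g w) + volume V := by rw [lintegral_sub_right_eq_self]

end Plane

/-! ### A minorant of the Riemannian distance with integrable inverse. -/

section Kernel

open Manifold

variable {H S : Type*} [TopologicalSpace H] (I : ModelWithCorners ℝ (EuclideanSpace ℝ (Fin 2)) H)
  [TopologicalSpace S] [T2Space S] [CompactSpace S] [ChartedSpace H S] [IsManifold I ∞ S]
  [RiemannianBundle (fun x : S => TangentSpace I x)]
  [IsContinuousRiemannianBundle (EuclideanSpace ℝ (Fin 2)) (fun x : S => TangentSpace I x)]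
  [MeasurableSpace S] [BorelSpace S]

/-- Near `p`, the area is dominated by a finite measure `ν`, and the Riemannian distance is bounded
below by a distance whose inverse is uniformly `ν`-integrable in one variable. -/
theorem exists_local_kernel (p : S) : ∃ (ν : Measure S) (ψ : S → EuclideanSpace ℝ (Fin 2))
    (C B : ℝ≥0), IsFiniteMeasure ν ∧
      (∀ᶠ U in (nhds p).smallSets, ∀ x : S, ∀ A ⊆ U, MeasurableSet A → chartArea I x A ≤ ν A) ∧
      Continuous ψ ∧ C ≠ 0 ∧ (∀ x y, edist (ψ x) (ψ y) / C ≤ riemannianEDist I x y) ∧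
      ∀ u, ∫⁻ z, (edist u (ψ z))⁻¹ ∂ν ≤ B := by
  obtain ⟨K, hK⟩ := exists_chartArea_le (I := I) p
  -- Cutting off the chart gives a smooth map on all of `S`, hence a globally Lipschitz one, that
  -- still equals the chart near `p`.
  obtain ⟨χ⟩ : Nonempty (SmoothBumpFunction I p) := inferInstance
  have hψ : ContMDiff I 𝓘(ℝ, EuclideanSpace ℝ (Fin 2)) ∞ fun x => χ x • extChartAt I p x :=
    χ.contMDiff_smul contMDiffOn_extChartAt
  obtain ⟨C, hC0, hC⟩ := exists_edist_div_le_riemannianEDist hψ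
  have hball : ∀ᶠ x in nhds p, extChartAt I p x ∈ Metric.ball (extChartAt I p p) 1 :=
    continuousAt_extChartAt p (Metric.ball_mem_nhds _ one_pos)
  obtain ⟨U, hU, hUo, hpU⟩ := eventually_nhds_iff.1
    ((hball.and χ.eventuallyEq_one).and (extChartAt_source_mem_nhds (I := I) p))
  have hVm := measurableSet_target_inter_preimage (I := I) p hUo.measurableSet
  set V := (extChartAt I p).target ∩ (extChartAt I p).symm ⁻¹' U with hV
  have hVfin : volume V ≠ ⊤ := by
    refine ((measure_mono ?_).trans_lt (measure_ball_lt_top (x := extChartAt I p p) (r := 1))).ne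
    rintro w ⟨hw, hwU⟩
    rw [← (extChartAt I p).right_inv hw]
    exact (hU _ hwU).1.1
  have hVψ : ∀ w ∈ V, χ ((extChartAt I p).symm w) •
      extChartAt I p ((extChartAt I p).symm w) = w := by
    rintro w ⟨hw, hwU⟩
    rw [(extChartAt I p).right_inv hw, (hU _ hwU).1.2]
    exact one_smul _ _
  obtain ⟨B, hB⟩ := exists_lintegral_inv_edist_le hVfin
  have hmeas : AEMeasurable (extChartAt I p).symm (volume.restrict V) :=
    ((continuousOn_extChartAt_symm p).mono inter_subset_left).aemeasurable hVm
  have : IsFiniteMeasure (volume.restrict V) := isFiniteMeasure_restrict.2 hVfin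
  refine ⟨K • (volume.restrict V).map (extChartAt I p).symm, fun x => χ x • extChartAt I p x, C,
    K * B, inferInstance, ?_, hψ.continuous, hC0, hC, fun u => ?_⟩
  · have hU' : ∀ᶠ W in (nhds p).smallSets, W ⊆ U := by
      rw [Filter.eventually_smallSets]
      exact ⟨U, hUo.mem_nhds hpU, fun W h => h⟩
    filter_upwards [hK, hU'] with W hW hWU x A hA hAm
    refine (hW x A hA hAm).trans_eq ?_
    rw [Measure.smul_apply, Measure.map_apply_of_aemeasurable hmeas hAm,
      Measure.restrict_apply' hVm,
      (extChartAt I p).image_eq_target_inter_inv_preimage fun z hz => (hU z (hWU (hA hz))).2]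
    have : (extChartAt I p).symm ⁻¹' A ∩ V = (extChartAt I p).target ∩
        (extChartAt I p).symm ⁻¹' A := by
      ext w
      constructor
      · rintro ⟨h1, h2, h3⟩
        exact ⟨h2, h1⟩
      · rintro ⟨h1, h2⟩
        exact ⟨h2, h1, hWU (hA h2)⟩
    rw [this]
    rfl
  · have hm : Measurable fun z => (edist u (χ z • extChartAt I p z))⁻¹ :=
      (continuous_const.edist hψ.continuous).measurable.inv
    rw [lintegral_smul_measure, lintegral_map' hm.aemeasurable hmeas,
      setLIntegral_congr_fun hVm fun w hw => by rw [hVψ w hw], ENNReal.coe_mul]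
    exact mul_le_mul' le_rfl (hB u)

/-- The Riemannian distance is bounded below by a continuous function whose inverse is uniformly
integrable in one variable. -/
theorem exists_kernel : IsFiniteMeasure (area (S := S) I) ∧ ∃ δ : S → S → ℝ≥0∞,
    Continuous (Function.uncurry δ) ∧ (∀ x y, δ x y = δ y x) ∧
    (∀ x y, δ x y ≤ riemannianEDist I x y) ∧
    ∃ B : ℝ≥0, ∀ x, ∫⁻ y, (δ x y)⁻¹ ∂(area (S := S) I) ≤ B := by
  choose ν ψ C B hν hU hψ hC0 hC hB using exists_local_kernel (S := S) I
  have hU' : ∀ p, ∃ U : Set S, U ∈ nhds p ∧ MeasurableSet U ∧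
      ∀ x : S, ∀ A ⊆ U, MeasurableSet A → chartArea I x A ≤ ν p A := fun p => by
    obtain ⟨U, hUp, h⟩ := Filter.eventually_smallSets.1 (hU p)
    obtain ⟨W, hWU, hWo, hpW⟩ := mem_nhds_iff.1 hUp
    exact ⟨W, hWo.mem_nhds hpW, hWo.measurableSet, h W hWU⟩
  choose U hUn hUm hUA using hU'
  obtain ⟨t, ht⟩ := CompactSpace.elim_nhds_subcover U hUn
  have hle : area (S := S) I ≤ ∑ p ∈ t, ν p := by
    refine iSup_le fun x => Measure.le_iff.2 fun A hA => ?_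
    have hcov : A ⊆ ⋃ p ∈ t, A ∩ U p := by
      rw [← inter_iUnion₂, ht]
      exact subset_inter le_rfl (subset_univ _)
    rw [Measure.finsetSum_apply]
    refine (measure_mono hcov).trans ((measure_biUnion_finset_le _ _).trans ?_)
    exact Finset.sum_le_sum fun p _ => (hUA p x _ inter_subset_right (hA.inter (hUm p))).trans
      (measure_mono inter_subset_left)
  -- For each `p` in the cover, `δ⁻¹` is at most `C p / edist (ψ p x) (ψ p y)`, so its integral
  -- against `ν p` is controlled by the `p`-th chart alone. It does not matter that the individual
  -- distances may vanish off the diagonal.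
  refine ⟨isFiniteMeasure_of_le _ hle,
    fun x y => t.sup fun p => edist (ψ p x) (ψ p y) / C p, ?_, ?_, ?_, ∑ p ∈ t, C p * B p, ?_⟩
  · refine Continuous.finset_sup_apply (s := t) fun p _ => ?_
    exact (ENNReal.continuous_div_const _ (by simpa using hC0 p)).comp
      (((hψ p).comp continuous_fst).edist ((hψ p).comp continuous_snd))
  · intro x y
    simp only [edist_comm]
  · exact fun x y => Finset.sup_le fun p _ => hC p x y
  · intro x
    refine (lintegral_mono' hle le_rfl).trans ?_
    rw [lintegral_finsetSum_measure, ENNReal.ofNNReal_finsetSum]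
    refine Finset.sum_le_sum fun p hp => ?_
    rw [ENNReal.coe_mul]
    refine le_trans ?_ (mul_le_mul' le_rfl (hB p (ψ p x)))
    rw [← lintegral_const_mul' _ _ ENNReal.coe_ne_top]
    refine lintegral_mono fun y => ?_
    refine (ENNReal.inv_le_inv.2 (Finset.le_sup (f := fun p => edist (ψ p x) (ψ p y) / C p)
      hp)).trans_eq ?_
    rw [ENNReal.inv_div (Or.inl ENNReal.coe_ne_top) (Or.inl (by simpa using hC0 p)), div_eq_mul_inv]

end Kernel

/-! ### Integrating out one variable of the product. -/

section Tonelli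

variable {S : Type*} [MeasurableSpace S] (ν : Measure S) [IsFiniteMeasure ν]

theorem lintegral_pi_mul_kernel_le {n : ℕ} {h : S → ℝ≥0∞} (hh : Measurable h)
    {k : S → S → ℝ≥0∞} (hk : Measurable (Function.uncurry k)) (hsymm : ∀ x y, k x y = k y x)
    {B : ℝ≥0∞} (hB : ∀ x, ∫⁻ y, k x y ∂ν ≤ B) (i j l : Fin n) (hjl : j ≠ l) :
    ∫⁻ x : Fin n → S, h (x i) * k (x j) (x l) ∂(Measure.pi fun _ => ν) ≤
      B * ν univ ^ (n - 2) * ∫⁻ y, h y ∂ν := by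
  -- The variable to be integrated out must not occur in `h`. If `i = l`, the symmetry of `k` allows
  -- `j` to take its place. The case `i = j` is harmless.
  wlog hil : i ≠ l generalizing j l
  · rw [not_ne_iff] at hil
    simp only [fun x : Fin n → S => hsymm (x j) (x l)]
    exact this l j hjl.symm (hil ▸ hjl.symm)
  obtain ⟨m, rfl⟩ : ∃ m, n = m + 1 := ⟨n - 1, by have := i.pos; omega⟩
  obtain ⟨i, rfl⟩ := Fin.exists_succAbove_eq hil
  obtain ⟨j, rfl⟩ := Fin.exists_succAbove_eq hjl
  let g : S × (Fin m → S) → ℝ≥0∞ := fun q => h (q.2 i) * k (q.2 j) q.1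
  have hg : Measurable g := by
    have h1 : Measurable fun q : S × (Fin m → S) => (q.2 j, q.1) :=
      ((measurable_pi_apply j).comp measurable_snd).prodMk measurable_fst
    exact (hh.comp ((measurable_pi_apply i).comp measurable_snd)).mul (hk.comp h1)
  have hmp := measurePreserving_piFinSuccAbove (fun _ : Fin (m + 1) => ν) l
  calc ∫⁻ x : Fin (m + 1) → S, h (x (l.succAbove i)) * k (x (l.succAbove j)) (x l)
        ∂(Measure.pi fun _ => ν)
      = ∫⁻ q, g q ∂(ν.prod (Measure.pi fun _ => ν)) := hmp.lintegral_comp hg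
    _ = ∫⁻ z, ∫⁻ s, h (z i) * k (z j) s ∂ν ∂(Measure.pi fun _ => ν) :=
        lintegral_prod_symm' _ hg
    _ ≤ ∫⁻ z : Fin m → S, B * h (z i) ∂(Measure.pi fun _ => ν) := by
        refine lintegral_mono fun z => ?_
        have h1 : Measurable fun s => k (z j) s := hk.comp measurable_prodMk_left
        rw [lintegral_const_mul _ h1, mul_comm]
        exact mul_le_mul' (hB _) le_rfl
    _ = B * ν univ ^ (m + 1 - 2) * ∫⁻ y, h y ∂ν := by
        have h0 : Measurable fun z : Fin m → S => h (z i) := hh.comp (measurable_pi_apply i)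
        rw [lintegral_const_mul _ h0, mul_assoc]
        have h1 := lintegral_map (μ := Measure.pi fun _ : Fin m => ν) hh (measurable_pi_apply i)
        rw [← h1]
        -- The marginal of the product on `m = n - 1` factors is `ν` times the mass of the other `n
        -- - 2` factors.
        have h2 := Measure.pi_map_eval (μ := fun _ : Fin m => ν) i
        rw [show (fun x : Fin m → S => x i) = Function.eval i from rfl, h2, lintegral_smul_measure]
        simp [Finset.card_erase_of_mem]

end Tonelli

/-! ### Distance to the diagonals and the `g_b`-speed. -/

section Diagonal

open Manifold

variable {H S : Type*} [TopologicalSpace H] {I : ModelWithCorners ℝ (EuclideanSpace ℝ (Fin 2)) H}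
  [TopologicalSpace S] [ChartedSpace H S]
  [RiemannianBundle (fun x : S => TangentSpace I x)] {n : ℕ}

theorem enorm_mfderiv_eval_le_productNorm (x : Fin n → S) (v : TangentSpace (confModel I n) x)
    (i : Fin n) :
    ‖mfderiv (confModel I n) I (fun y : Fin n → S => y i) x v‖ₑ ≤ productNorm I n x v := by
  rw [← ofReal_norm, productNorm]
  refine ENNReal.ofReal_le_ofReal (Real.le_sqrt_of_sq_le ?_)
  exact Finset.single_le_sum (f := fun i =>
    ‖mfderiv (confModel I n) I (fun y : Fin n → S => y i) x v‖ ^ 2)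
    (fun _ _ => sq_nonneg _) (Finset.mem_univ i)

theorem productNorm_le_sum (x : Fin n → S) (v : TangentSpace (confModel I n) x) :
    productNorm I n x v ≤
      ∑ i, ‖mfderiv (confModel I n) I (fun y : Fin n → S => y i) x v‖ₑ := by
  simp only [← ofReal_norm]
  rw [productNorm, ← ENNReal.ofReal_sum_of_nonneg fun _ _ => norm_nonneg _]
  refine ENNReal.ofReal_le_ofReal (Real.sqrt_le_iff.2
    ⟨Finset.sum_nonneg fun _ _ => norm_nonneg _, ?_⟩)
  exact Finset.sum_sq_le_sq_sum_of_nonneg fun _ _ => norm_nonneg _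

/-- Each component of a path in `S^n` is at most as long as the path, because a component of a
vector is at most as long as the vector. -/
theorem riemannianEDist_le_productEDist (x y : Fin n → S) (i : Fin n) :
    riemannianEDist I (x i) (y i) ≤ productEDist I n x y := by
  refine le_of_forall_gt_imp_ge_of_dense fun r hr => ?_
  let _ : ∀ z : Fin n → S, ENorm (TangentSpace (confModel I n) z) := fun z => ⟨productNorm I n z⟩
  have hr' : riemannianEDist (confModel I n) x y < r := hr
  obtain ⟨γ, rfl, rfl, hγ, hlt⟩ := exists_lt_of_riemannianEDist_lt hr'
  have heval : ContMDiff (confModel I n) I 1 (fun y : Fin n → S => y i) :=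
    contMDiff_eval_piManifold (I := fun _ => I) i
  refine (riemannianEDist_le_pathELength (γ := fun t => γ t i) (heval.comp_contMDiffOn hγ) rfl rfl
    zero_le_one).trans (le_trans ?_ hlt.le)
  rw [pathELength_eq_lintegral_mfderivWithin_Icc, pathELength_eq_lintegral_mfderivWithin_Icc]
  refine setLIntegral_mono' measurableSet_Icc fun t ht => ?_
  have hcomp := mfderiv_comp_mfderivWithin t (heval.mdifferentiable one_ne_zero (γ t))
    (hγ.mdifferentiableOn one_ne_zero t ht)
    (uniqueDiffOn_Icc zero_lt_one t ht).uniqueMDiffWithinAt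
  have h1 : mfderivWithin 𝓘(ℝ, ℝ) I (fun t => γ t i) (Icc 0 1) t (1 : ℝ) =
      mfderiv (confModel I n) I (fun y : Fin n → S => y i) (γ t)
        (mfderivWithin 𝓘(ℝ, ℝ) (confModel I n) γ (Icc 0 1) t (1 : ℝ)) :=
    DFunLike.congr_fun hcomp (1 : ℝ)
  exact (congrArg enorm h1).trans_le (enorm_mfderiv_eval_le_productNorm _ _ i)

/-- The distance to the diagonals is bounded below by the distances between the points. -/
theorem inv_diagDist_le {δ : S → S → ℝ≥0∞} (hδ : ∀ x y, δ x y ≤ riemannianEDist I x y)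
    (x : Fin n → S) : (diagDist I n x)⁻¹ ≤
      ∑ p : Fin n × Fin n with p.1 ≠ p.2, 2 * (δ (x p.1) (x p.2))⁻¹ := by
  rw [ENNReal.inv_le_iff_inv_le]
  refine le_iInf₂ fun y ⟨i, j, hij, hy⟩ => ?_
  -- The factor `2` comes from going from `x i` to the common point `y i = y j` and on to `x j`,
  -- each leg being at most the distance from `x` to `y`.
  have h1 : (2 * (δ (x i) (x j))⁻¹)⁻¹ ≤ productEDist I n x y := by
    rw [ENNReal.mul_inv (by simp) (by simp), inv_inv, mul_comm, ← div_eq_mul_inv]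
    refine ENNReal.div_le_of_le_mul' ?_
    rw [two_mul]
    calc δ (x i) (x j) ≤ riemannianEDist I (x i) (x j) := hδ _ _
      _ ≤ riemannianEDist I (x i) (y i) + riemannianEDist I (y j) (x j) := by
          rw [← hy]
          exact riemannianEDist_triangle
      _ ≤ productEDist I n x y + productEDist I n x y := by
          rw [riemannianEDist_comm (x := y j)]
          exact add_le_add (riemannianEDist_le_productEDist x y i)
            (riemannianEDist_le_productEDist x y j)
  refine le_trans (ENNReal.inv_le_inv.2 ?_) h1
  exact Finset.single_le_sum (f := fun p : Fin n × Fin n => 2 * (δ (x p.1) (x p.2))⁻¹)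
    (fun _ _ => zero_le) (Finset.mem_filter.2 ⟨Finset.mem_univ (i, j), hij⟩)

variable [T2Space S]

/-- By the chain rule through the inclusion and the coordinate projections, the components of the
product velocity are the velocities of `F` at the points `x i`. -/
theorem IsIsotopy.gbNorm_velocity_le {F : ℝ → Equiv.Perm S} {f : Equiv.Perm S}
    (hF : IsIsotopy I F f) {t : ℝ} (ht : t ∈ Icc (0 : ℝ) 1) (x : Conf S n) :
    gbNorm I n (productMap n (F t) x) (mfderivWithin 𝓘(ℝ, ℝ) (confModel I n)
        (fun s : ℝ => productMap n (F s) x) (Icc 0 1) t (1 : ℝ)) ≤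
      (∑ i, ‖mfderivWithin 𝓘(ℝ, ℝ) I (fun s : ℝ => F s (x.1 i)) (Icc 0 1) t (1 : ℝ)‖ₑ) *
        (diagDist I n fun i => F t (x.1 i))⁻¹ := by
  rw [gbNorm, div_eq_mul_inv]
  refine mul_le_mul' ((productNorm_le_sum _ _).trans_eq (Finset.sum_congr rfl fun i _ => ?_)) le_rfl
  have hval : ContMDiff (confModel I n) (confModel I n) ∞
    (Subtype.val : Conf S n → (Fin n → S)) := contMDiff_subtype_val
  have heval : ContMDiff (confModel I n) I ∞ (fun y : Fin n → S => y i) :=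
    contMDiff_eval_piManifold (I := fun _ => I) i
  have hu : UniqueMDiffWithinAt 𝓘(ℝ, ℝ) (Icc (0 : ℝ) 1) t :=
    (uniqueDiffOn_Icc zero_lt_one t ht).uniqueMDiffWithinAt
  have hd := (isIsotopy_productMap hF).mdifferentiableWithinAt x ht
  have h1 := mfderiv_comp_mfderivWithin t
    (hval.mdifferentiable (by simp) (productMap n (F t) x)) hd hu
  have h2 := mfderiv_comp_mfderivWithin t
    (heval.mdifferentiable (by simp) (productMap n (F t) x).1)
    ((hval.mdifferentiable (by simp) _).comp_mdifferentiableWithinAt t hd) hu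
  have h3 : mfderivWithin 𝓘(ℝ, ℝ) I (fun s : ℝ => F s (x.1 i)) (Icc 0 1) t (1 : ℝ) =
      mfderiv (confModel I n) I (fun y : Fin n → S => y i) (productMap n (F t) x).1
        (mfderiv (confModel I n) (confModel I n) (Subtype.val : Conf S n → (Fin n → S))
          (productMap n (F t) x) (mfderivWithin 𝓘(ℝ, ℝ) (confModel I n)
            (fun s : ℝ => productMap n (F s) x) (Icc 0 1) t (1 : ℝ))) :=
    (DFunLike.congr_fun h2 (1 : ℝ)).trans (congrArg _ (DFunLike.congr_fun h1 (1 : ℝ)))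
  exact (congrArg enorm h3).symm

end Diagonal

/-! ### Comparison of the lengths of the two isotopies. -/

section Length

open Manifold

variable {H S : Type*} [TopologicalSpace H] {I : ModelWithCorners ℝ (EuclideanSpace ℝ (Fin 2)) H}
  [TopologicalSpace S] [T2Space S] [SecondCountableTopology S] [ChartedSpace H S]
  [RiemannianBundle (fun x : S => TangentSpace I x)]
  [MeasurableSpace S] [BorelSpace S] {n : ℕ}

theorem lintegral_confMeasure_le (g : (Fin n → S) → ℝ≥0∞) :
    ∫⁻ x : Conf S n, g x.1 ∂(confMeasure (S := S) I n) ≤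
      ∫⁻ x, g x ∂(Measure.pi fun _ => area (S := S) I) :=
  (lintegral_subtype_comap (measurableSet_conf (S := S) n) g).trans_le
    (setLIntegral_le_lintegral _ _)

variable [IsManifold I ∞ S] [IsFiniteMeasure (area (S := S) I)]
  [IsContinuousRiemannianBundle (EuclideanSpace ℝ (Fin 2)) (fun x : S => TangentSpace I x)]

/-- The length of the product isotopy is controlled by the length of the isotopy, if the
Riemannian distance is bounded below by a function `δ` whose inverse is uniformly integrable in one
variable. -/
theorem IsIsotopy.isotopyLength_productMap_le {δ : S → S → ℝ≥0∞}
    (hδm : Continuous (Function.uncurry δ)) (hsymm : ∀ x y, δ x y = δ y x)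
    (hδ : ∀ x y, δ x y ≤ riemannianEDist I x y) {B : ℝ≥0∞} (hBtop : B ≠ ⊤)
    (hB : ∀ x, ∫⁻ y, (δ x y)⁻¹ ∂(area (S := S) I) ≤ B)
    {F : ℝ → Equiv.Perm S} {f : Equiv.Perm S} (hF : IsIsotopy I F f)
    (hFμ : ∀ t ∈ Icc (0 : ℝ) 1, MeasurePreserving (F t) (area (S := S) I) (area (S := S) I)) :
    isotopyLength (confModel I n) (gbNorm I n) (confMeasure (S := S) I n)
        (fun t => productMap n (F t)) ≤
      (∑ _i : Fin n, ∑ p : Fin n × Fin n with p.1 ≠ p.2,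
        2 * (B * area (S := S) I univ ^ (n - 2))) *
      isotopyLength I (fun (x : S) (v : TangentSpace I x) => ‖v‖ₑ) (area (S := S) I) F := by
  have hconst : (∑ _i : Fin n, ∑ p : Fin n × Fin n with p.1 ≠ p.2,
      2 * (B * area (S := S) I univ ^ (n - 2))) ≠ ⊤ :=
    ENNReal.sum_ne_top.2 fun _ _ => ENNReal.sum_ne_top.2 fun _ _ =>
      ENNReal.mul_ne_top (by simp) (ENNReal.mul_ne_top hBtop
        (ENNReal.pow_ne_top (measure_ne_top _ _)))
  rw [isotopyLength, isotopyLength, ← lintegral_const_mul' _ _ hconst]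
  refine setLIntegral_mono' measurableSet_Icc fun t ht => ?_
  let V : S → ℝ≥0∞ := fun x =>
    ‖mfderivWithin 𝓘(ℝ, ℝ) I (fun s : ℝ => F s x) (Icc 0 1) t (1 : ℝ)‖ₑ
  have hV : Measurable V := (hF.continuous_speed ht).measurable
  let k : S → S → ℝ≥0∞ := fun x y => (δ (F t x) (F t y))⁻¹
  have hk : Measurable (Function.uncurry k) := by
    have h1 : Measurable fun q : S × S => (F t q.1, F t q.2) :=
      ((hFμ t ht).measurable.comp measurable_fst).prodMk
        ((hFμ t ht).measurable.comp measurable_snd)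
    exact (hδm.measurable.comp h1).inv
  -- Area preservation enters here: substituting `F t y` for `y` makes the bound on the kernel
  -- independent of the isotopy and of time.
  have hkB : ∀ x, ∫⁻ y, k x y ∂(area (S := S) I) ≤ B := fun x => by
    have h1 : Measurable fun y => (δ (F t x) y)⁻¹ :=
      (hδm.measurable.comp measurable_prodMk_left).inv
    exact ((hFμ t ht).lintegral_comp h1).trans_le (hB _)
  have hterm : ∀ (i : Fin n) (p : Fin n × Fin n),
      Measurable fun x : Fin n → S => V (x i) * (2 * k (x p.1) (x p.2)) := fun i p => by
    have h1 : Measurable fun x : Fin n → S => (x p.1, x p.2) :=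
      (measurable_pi_apply _).prodMk (measurable_pi_apply _)
    exact (hV.comp (measurable_pi_apply i)).mul ((hk.comp h1).const_mul 2)
  calc _ ≤ ∫⁻ x : Conf S n, (fun y : Fin n → S => ∑ i, ∑ p : Fin n × Fin n with p.1 ≠ p.2,
          V (y i) * (2 * k (y p.1) (y p.2))) x.1 ∂(confMeasure (S := S) I n) := by
        refine lintegral_mono fun x => (hF.gbNorm_velocity_le ht x).trans ?_
        simp only [← Finset.mul_sum, ← Finset.sum_mul]
        exact mul_le_mul' le_rfl ((inv_diagDist_le hδ _).trans_eq (Finset.mul_sum _ _ _).symm)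
    _ ≤ ∫⁻ y : Fin n → S, ∑ i, ∑ p : Fin n × Fin n with p.1 ≠ p.2,
          V (y i) * (2 * k (y p.1) (y p.2)) ∂(Measure.pi fun _ => area (S := S) I) :=
        lintegral_confMeasure_le _
    _ = ∑ i, ∑ p : Fin n × Fin n with p.1 ≠ p.2, ∫⁻ y : Fin n → S,
          V (y i) * (2 * k (y p.1) (y p.2)) ∂(Measure.pi fun _ => area (S := S) I) := by
        rw [lintegral_finsetSum _ fun i _ => Finset.measurable_sum _ fun p _ => hterm i p]
        exact Finset.sum_congr rfl fun i _ => lintegral_finsetSum _ fun p _ => hterm i p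
    _ ≤ ∑ _i : Fin n, ∑ p : Fin n × Fin n with p.1 ≠ p.2,
          2 * (B * area (S := S) I univ ^ (n - 2)) * ∫⁻ y, V y ∂(area (S := S) I) := by
        refine Finset.sum_le_sum fun i _ => Finset.sum_le_sum fun p hp => ?_
        simp only [mul_left_comm (V _) 2]
        rw [lintegral_const_mul' _ _ (by simp), mul_assoc]
        exact mul_le_mul' le_rfl (lintegral_pi_mul_kernel_le _ hV hk
          (fun x y => congrArg (fun r => r⁻¹) (hsymm _ _)) hkB i p.1 p.2 (Finset.mem_filter.1 hp).2)
    _ = _ := by simp only [← Finset.sum_mul]; rfl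

end Length

end SurfaceDiff
end
/-- `S` is a compact connected smooth Riemannian surface, with or without boundary (the model `I`
is arbitrary). -/
theorem lemma5p2
    {H S : Type*} [TopologicalSpace H]
    (I : ModelWithCorners ℝ (EuclideanSpace ℝ (Fin 2)) H)
    [TopologicalSpace S] [T2Space S] [CompactSpace S] [ConnectedSpace S]
    [ChartedSpace H S] [IsManifold I ∞ S]
    [RiemannianBundle (fun x : S => TangentSpace I x)]
    [IsContMDiffRiemannianBundle I ∞ (EuclideanSpace ℝ (Fin 2)) (fun x : S => TangentSpace I x)]
    [MeasurableSpace S] [BorelSpace S]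
    (n : ℕ) (hn : 2 ≤ n) :
    MapsTo (SurfaceDiff.productMap n) (SurfaceDiff.Diff0 I (SurfaceDiff.area (S := S) I))
      (SurfaceDiff.Diff0 (SurfaceDiff.confModel I n) (SurfaceDiff.confMeasure (S := S) I n)) ∧
    InjOn (SurfaceDiff.productMap n) (SurfaceDiff.Diff0 I (SurfaceDiff.area (S := S) I)) ∧
    ∃ C : ℝ≥0, ∀ f ∈ SurfaceDiff.Diff0 I (SurfaceDiff.area (S := S) I),
      SurfaceDiff.l1Norm (SurfaceDiff.confModel I n) (SurfaceDiff.gbNorm I n)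
          (SurfaceDiff.confMeasure (S := S) I n) (SurfaceDiff.productMap n f) ≤
        C * SurfaceDiff.l1Norm I (fun (x : S) (v : TangentSpace I x) => ‖v‖ₑ)
          (SurfaceDiff.area (S := S) I) f := by
  have := SurfaceDiff.secondCountableTopology_of_model I (M := S)
  have := SurfaceDiff.infinite_of_model I (M := S)
  have := SurfaceDiff.isContinuousRiemannianBundle_of_contMDiff (J := I) (M := S)
  obtain ⟨hfin, δ, hδm, hsymm, hδ, B, hB⟩ := SurfaceDiff.exists_kernel (S := S) I
  have hmaps := SurfaceDiff.mapsTo_productMap (S := S) (I := I) n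
  refine ⟨hmaps, (SurfaceDiff.injective_productMap (by omega)).injOn, ?_⟩
  -- The summand `1` makes `C` nonzero, so that `C` commutes with the infima and `C * ∞ = ∞` when no
  -- isotopy exists.
  let C : ℝ≥0 := (∑ _i : Fin n, ∑ p : Fin n × Fin n with p.1 ≠ p.2,
    2 * (B * (SurfaceDiff.area (S := S) I univ).toNNReal ^ (n - 2))) + 1
  have hC : (∑ _i : Fin n, ∑ p : Fin n × Fin n with p.1 ≠ p.2,
      2 * (B * SurfaceDiff.area (S := S) I univ ^ (n - 2))) ≤ (C : ℝ≥0∞) := by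
    simp only [C, ENNReal.coe_add, ENNReal.ofNNReal_finsetSum, ENNReal.coe_mul, ENNReal.coe_pow,
      ENNReal.coe_toNNReal (measure_ne_top _ _), ENNReal.coe_ofNat]
    exact le_self_add
  have hC0 : (C : ℝ≥0∞) ≠ 0 := by
    simp [C]
  refine ⟨C, fun f _ => ?_⟩
  simp only [SurfaceDiff.l1Norm, ENNReal.mul_iInf_of_ne hC0 ENNReal.coe_ne_top]
  refine le_iInf fun F => le_iInf fun hF => le_iInf fun hFμ => ?_
  refine (iInf_le _ fun t => SurfaceDiff.productMap n (F t)).trans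
    ((iInf_le _ (SurfaceDiff.isIsotopy_productMap hF)).trans
      ((iInf_le _ fun t ht => hmaps (hFμ t ht)).trans ?_))
  exact (hF.isotopyLength_productMap_le hδm hsymm hδ ENNReal.coe_ne_top hB
    fun t ht => (hFμ t ht).2.1).trans (mul_le_mul' hC le_rfl)
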